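/- Let $G=\prod_{j=0}^{\infty}\mathbb{Z}_2$ be the dyadic group with normalized Haar measure $\mu$ (the product of the uniform measures on $\mathbb{Z}_2$). For $n\in\mathbb{N}=\{0,1,2,\dots\}$ and $x\in G$ put $I_n(x)=\{y\in G: y_j=x_j \text{ for } j<n\}$ and let $\zeta_n$ be the $\sigma$-algebra generated by $\{I_n(x):x\in G\}$. For $n=\sum_{k} n_k2^k$ with $n_k\in\{0,1\}$ let $w_n(x)=\prod_{k}(-1)^{n_kx_k}$ be the $n$-th Walsh function. For a (real or complex) martingale $F=(F_n)_{n\in\mathbb{N}}$ with respect to $(\zeta_n)_{n\in\mathbb{N}}$ put $\widehat F(k)=\lim_{n\to\infty}\int_G F_nw_k\,d\mu$, $S_nF=\sum_{k=0}^{n-1}\widehat F(k)w_k$ and, for $n\ge 1$, $\sigma_nF=\frac1n\sum_{k=1}^nS_kF$. With $\|f\|_{1/2}=\left(\int_G|f|^{1/2}\,d\mu\right)^{2}$, let $H_{1/2}(G)$ consist of all such martingales with $\|F\|_{H_{1/2}}:=\left\|\sup_{n}|F_n|\right\|_{1/2}<\infty$. Then the restricted maximal operators $$\sup_{k\in\mathbb{N}}|\sigma_{2^k}F|,\qquad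 \sup_{k\in\mathbb{N}}|\sigma_{2^k+1}F|,\qquad \sup_{k\in\mathbb{N}}|\sigma_{2^k+2^{[k/2]}}F|,$$ where $[\cdot]$ denotes the integer part, are all bounded from $H_{1/2}(G)$ to $L_{1/2}(G)$: for each of them, denoted $T$, there is a finite constant $C$ such that $TF\in L_{1/2}(G)$ and $\|TF\|_{1/2}\le C\|F\|_{H_{1/2}}$ for every $F\in H_{1/2}(G)$. -/

import Mathlib

open MeasureTheory ProbabilityTheory Filter Topology
open scoped ENNReal NNReal

namespace WalshFejer

/-- The dyadic group: the complete direct product of countably many copies of `Z_2`. -/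
abbrev G : Type := ℕ → ZMod 2

/-- The uniform probability measure on `Z_2` (every singleton has measure `1/2`). -/
noncomputable def muZ2 : Measure (ZMod 2) := (2⁻¹ : ℝ≥0∞) • Measure.count

instance : IsProbabilityMeasure muZ2 := by
  constructor
  rw [muZ2, Measure.smul_apply, Measure.count_univ, ENat.card_eq_coe_fintype_card, ZMod.card]
  simp [ENNReal.inv_mul_cancel]

/-- The normalized Haar measure on `G`, i.e. the product of the uniform measures on `Z_2`. -/
noncomputable def mu : Measure G := Measure.infinitePi (fun _ : ℕ => muZ2)

instance : IsProbabilityMeasure mu := by unfold mu; infer_instance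

/-- The dyadic interval `I_n(x)`. -/
def dyadicInterval (n : ℕ) (x : G) : Set G := {y | ∀ j < n, y j = x j}

theorem measurableSet_dyadicInterval (n : ℕ) (x : G) : MeasurableSet (dyadicInterval n x) := by
  have h : dyadicInterval n x = ⋂ j ∈ Finset.range n, {y : G | y j = x j} := by
    ext y; simp [dyadicInterval]
  rw [h]
  exact Finset.measurableSet_biInter _ fun j _ =>
    measurableSet_eq_fun (measurable_pi_apply j) measurable_const

theorem dyadicInterval_eq_iUnion {m n : ℕ} (hmn : m ≤ n) (x : G) :
    dyadicInterval m x = ⋃ t : {t : Fin n → ZMod 2 // ∀ j : Fin n, j.1 < m → t j = x j},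
      dyadicInterval n (fun j => if h : j < n then t.1 ⟨j, h⟩ else 0) := by
  ext y
  simp only [dyadicInterval, Set.mem_ofPred_eq, Set.mem_iUnion]
  constructor
  · intro h
    refine ⟨⟨fun j => y j, fun j hj => h j hj⟩, fun j hj => by simp [hj]⟩
  · rintro ⟨⟨t, ht⟩, h⟩ j hj
    have hjn : j < n := lt_of_lt_of_le hj hmn
    have h1 := h j hjn
    simp only [hjn, dif_pos] at h1
    rw [h1]
    exact ht ⟨j, hjn⟩ hj

/-- The dyadic filtration: the `n`-th σ-algebra is generated by the intervals `I_n(x)`. -/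
def dyadicFiltration : Filtration ℕ (inferInstance : MeasurableSpace G) where
  seq n := MeasurableSpace.generateFrom {s | ∃ x : G, s = dyadicInterval n x}
  mono' := by
    intro m n hmn
    refine MeasurableSpace.generateFrom_le ?_
    rintro s ⟨x, rfl⟩
    rw [dyadicInterval_eq_iUnion hmn x]
    exact MeasurableSet.iUnion fun t => MeasurableSpace.measurableSet_generateFrom ⟨_, rfl⟩
  le' := by
    intro n
    refine MeasurableSpace.generateFrom_le ?_
    rintro s ⟨x, rfl⟩
    exact measurableSet_dyadicInterval n x

/-- The `k`-th Rademacher function `(-1)^{x_k}`. -/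
def rademacher (k : ℕ) (x : G) : ℝ := (-1) ^ (x k).val

/-- The `n`-th Walsh(–Paley) function `∏_k r_k^{n_k}`, where `n = ∑ n_k 2^k`. The binary digits
`n_k` with `k ≥ n.size` all vanish, so the product over `k < n.size` is the whole product. -/
def walsh (n : ℕ) (x : G) : ℝ :=
  ∏ k ∈ Finset.range n.size, rademacher k x ^ (n.testBit k).toNat

variable {𝕜 : Type*} [RCLike 𝕜]

/-- The maximal function `F^* = sup_n |F_n|`, with values in `[0, ∞]`. -/
noncomputable def maximalFunction (F : ℕ → G → 𝕜) (x : G) : ℝ≥0∞ := ⨆ n, ‖F n x‖ₑ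

/-- The Hardy (quasi-)norm `‖F‖_{H_p} = ‖F^*‖_p`, with values in `[0, ∞]`. -/
noncomputable def hardyNorm (p : ℝ≥0∞) (F : ℕ → G → 𝕜) : ℝ≥0∞ :=
  eLpNorm (maximalFunction F) p mu

/-- `F ∈ H_p(G)`: `F` is a dyadic martingale and `‖F‖_{H_p} < ∞`. -/
def MemHardy (p : ℝ≥0∞) (F : ℕ → G → 𝕜) : Prop :=
  Martingale F dyadicFiltration mu ∧ hardyNorm p F < ∞

/-- The `k`-th Walsh–Fourier coefficient `lim_n ∫ F_n w_k dμ` of a martingale `F`. The limit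
exists for every dyadic martingale, see `tendsto_walshFourierCoeff`. -/
noncomputable def walshFourierCoeff (F : ℕ → G → 𝕜) (k : ℕ) : 𝕜 :=
  limUnder atTop (fun n => ∫ x, walsh k x • F n x ∂mu)

/-- The partial sums `S_n F = ∑_{k < n} F̂(k) w_k`. -/
noncomputable def partialSum (n : ℕ) (F : ℕ → G → 𝕜) (x : G) : 𝕜 :=
  ∑ k ∈ Finset.range n, walsh k x • walshFourierCoeff F k

/-- The Fejér means `σ_n F = (1/n) ∑_{k=1}^n S_k F` (for `n ≥ 1`). -/
noncomputable def fejerMean (n : ℕ) (F : ℕ → G → 𝕜) (x : G) : 𝕜 :=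
  (n : 𝕜)⁻¹ * ∑ k ∈ Finset.Icc 1 n, partialSum k F x

/-- The restricted maximal operator `sup_k |σ_{n_k} F|`, with values in `[0, ∞]`. -/
noncomputable def restrictedMaximal (n : ℕ → ℕ) (F : ℕ → G → 𝕜) (x : G) : ℝ≥0∞ :=
  ⨆ k, ‖fejerMean (n k) F x‖ₑ

/-- The operator `T`, acting on martingales with scalars in `𝕜`, is bounded from `H_p(G)` to
`L_p(G)`: it maps `H_p(G)` to `L_p(G)` and `‖T F‖_p ≤ C ‖F‖_{H_p}` with one constant `C`. -/
def BoundedHardyLp (p : ℝ≥0∞) (T : (ℕ → G → 𝕜) → G → ℝ≥0∞) : Prop :=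
  ∃ C : ℝ≥0, ∀ F : ℕ → G → 𝕜, MemHardy p F →
    MemLp (T F) p mu ∧ eLpNorm (T F) p mu ≤ C * hardyNorm p F

theorem stronglyMeasurable_walsh (k : ℕ) :
    StronglyMeasurable[dyadicFiltration k.size] (walsh k) := by
  let _ : MeasurableSpace G := dyadicFiltration k.size
  have hm : Measurable (walsh k) := by
    intro s _
    have : walsh k ⁻¹' s = ⋃ t : {t : Fin k.size → ZMod 2 //
        walsh k (fun j => if h : j < k.size then t ⟨j, h⟩ else 0) ∈ s},
        dyadicInterval k.size (fun j => if h : j < k.size then t.1 ⟨j, h⟩ else 0) := by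
      have key : ∀ x y : G, x ∈ dyadicInterval k.size y → walsh k x = walsh k y := by
        intro x y h
        refine Finset.prod_congr rfl fun j hj => ?_
        rw [rademacher, rademacher, h j (Finset.mem_range.1 hj)]
      ext y
      simp only [Set.mem_preimage, Set.mem_iUnion]
      constructor
      · intro h
        have hy : y ∈ dyadicInterval k.size
            (fun j => if h : j < k.size then y j else 0) := fun j hj => by simp [hj]
        exact ⟨⟨fun j => y j, (key _ _ hy) ▸ h⟩, hy⟩
      · rintro ⟨⟨t, ht⟩, h⟩
        rw [key _ _ h]
        exact ht
    rw [this]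
    exact MeasurableSet.iUnion fun t => MeasurableSpace.measurableSet_generateFrom ⟨_, rfl⟩
  exact hm.stronglyMeasurable

theorem abs_walsh_le (k : ℕ) (x : G) : ‖walsh k x‖ ≤ 1 := by
  rw [walsh, norm_prod]
  refine Finset.prod_le_one (fun _ _ => norm_nonneg _) fun j _ => ?_
  simp [rademacher]

/-- For a dyadic martingale the integrals `∫ F_n w_k dμ` are eventually constant in `n`, so the
limit defining the Walsh–Fourier coefficients exists. -/
theorem tendsto_walshFourierCoeff {F : ℕ → G → 𝕜} (hF : Martingale F dyadicFiltration mu) (k : ℕ) :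
    Tendsto (fun n => ∫ x, walsh k x • F n x ∂mu) atTop (𝓝 (walshFourierCoeff F k)) := by
  have hconst : ∀ n, k.size ≤ n →
      ∫ x, walsh k x • F n x ∂mu = ∫ x, walsh k x • F k.size x ∂mu := by
    intro n hn
    have hsm := stronglyMeasurable_walsh k
    have hle := dyadicFiltration.le k.size
    have hint : Integrable (walsh k • F n) mu :=
      (hF.integrable n).bdd_smul 1 (hsm.mono hle).aestronglyMeasurable
        (ae_of_all _ (abs_walsh_le k))
    have h1 := condExp_smul_of_aestronglyMeasurable_left (μ := mu)
      hsm.aestronglyMeasurable hint (hF.integrable n)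
    have h2 := hF.2 _ _ hn
    change ∫ x, (walsh k • F n) x ∂mu = _
    rw [← integral_condExp hle]
    refine integral_congr_ae ?_
    filter_upwards [h1, h2] with x hx1 hx2
    rw [hx1, Pi.smul_apply', hx2]
  refine tendsto_nhds_limUnder ⟨∫ x, walsh k x • F k.size x ∂mu, ?_⟩
  exact tendsto_const_nhds.congr' (by
    filter_upwards [eventually_ge_atTop k.size] with n hn
    exact (hconst n hn).symm)

end WalshFejer

/-!
The Fejér sum of order `2 ^ s` is, up to one extra term, half the sum of the translates by the
`t`-th unit vectors, `t ≤ s`, of the Dirichlet sum of order `2 ^ s`, with weights `2 ^ t`. Cutting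
`n` at its binary digits writes the Fejér sum of order `n` in terms of such sums over blocks of
`2 ^ a` consecutive frequencies, one for each digit `a` of `n`, and the Dirichlet sum over a block
is bounded by the average of `|F_m|` over the dyadic intervals of level `a`, for `m = log₂ n + 1`.

Let `b_m` be the square root of `max_{i ≤ m} |F_i|`. The sequence `b` is increasing and adapted, so
the integrals of its increments add up to at most the integral of `sup_m |F_m| ^ (1/2)`. By
Minkowski's inequality in `L²` the square root of the average of `b_m ^ 2` is controlled by averages
of these increments, and Nikolskii's inequality together with the normalization by `2 ^ (-log₂ n)`
leaves weights decaying geometrically with ratio `2 ^ (-1/2)`. Because the exponent is `1/2`, sums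
of squares are dominated by squares of sums, and the supremum over `n` may be replaced by a sum over
`log₂ n`, as long as the orders `n` of a given `log₂ n` have their digits in boundedly many places.
-/

namespace WalshFejer

/-! ### Walsh functions as characters -/

theorem rademacher_add (k : ℕ) (x y : G) :
    rademacher k (x + y) = rademacher k x * rademacher k y := by
  have neg_one_pow_val_add : ∀ a b : ZMod 2,
      (-1 : ℤ) ^ (a + b).val = (-1) ^ a.val * (-1) ^ b.val := by
    decide
  simp only [rademacher, Pi.add_apply]
  exact_mod_cast neg_one_pow_val_add (x k) (y k)

theorem walsh_eq_prod {n m : ℕ} (h : n < 2 ^ m) (x : G) :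
    walsh n x = ∏ k ∈ Finset.range m, rademacher k x ^ (n.testBit k).toNat := by
  refine Finset.prod_subset (Finset.range_mono (Nat.size_le.2 h)) fun k _ hk => ?_
  rw [Finset.mem_range, not_lt] at hk
  rw [Nat.testBit_lt_two_pow (Nat.size_le.1 hk), Bool.toNat_false, pow_zero]

theorem walsh_zero (x : G) : walsh 0 x = 1 := by
  simp [walsh]

theorem walsh_apply_add (n : ℕ) (x y : G) : walsh n (x + y) = walsh n x * walsh n y := by
  simp only [walsh, rademacher_add, mul_pow, Finset.prod_mul_distrib]

theorem walsh_add {N l m : ℕ} (hN : 2 ^ m ∣ N) (hl : l < 2 ^ m) (x : G) :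
    walsh (N + l) x = walsh N x * walsh l x := by
  obtain ⟨q, rfl⟩ := hN
  set K := 2 ^ m * q + l
  have hK : K < 2 ^ K := Nat.lt_two_pow_self
  rw [walsh_eq_prod hK, walsh_eq_prod ((Nat.le_add_right _ _).trans_lt hK),
    walsh_eq_prod ((Nat.le_add_left _ _).trans_lt hK), ← Finset.prod_mul_distrib]
  refine Finset.prod_congr rfl fun k _ => ?_
  rw [← pow_add, Nat.testBit_two_pow_mul_add q hl, Nat.testBit_two_pow_mul]
  by_cases hk : k < m
  · simp [hk, hk.not_ge]
  · simp [hk, not_lt.1 hk,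
      Nat.testBit_lt_two_pow (hl.trans_le (Nat.pow_le_pow_right two_pos (not_lt.1 hk)))]

theorem walsh_two_pow (n : ℕ) (x : G) : walsh (2 ^ n) x = rademacher n x := by
  rw [walsh, Nat.size_pow, Finset.prod_range_succ, Finset.prod_eq_one]
  · simp
  · intro k hk
    simp [Nat.testBit_two_pow_of_ne (Finset.mem_range.1 hk).ne']

theorem walsh_single (k t : ℕ) : walsh k (Pi.single t 1) = 1 - 2 * (k.testBit t).toNat := by
  have hk : k < 2 ^ (k + (t + 1)) :=
    Nat.lt_two_pow_self.trans_le (Nat.pow_le_pow_right two_pos (Nat.le_add_right k _))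
  rw [walsh_eq_prod hk, Finset.prod_eq_single_of_mem t (Finset.mem_range.2 (by omega))]
  · cases k.testBit t <;> norm_num [rademacher, ZMod.val_one]
  · intro j _ hj
    simp [rademacher, hj]

theorem measurable_walsh (k : ℕ) : Measurable (walsh k) :=
  ((stronglyMeasurable_walsh k).mono (dyadicFiltration.le _)).measurable

theorem one_add_rademacher (n : ℕ) (x : G) :
    1 + rademacher n x = if x n = 0 then 2 else 0 := by
  have eq_one : ∀ a : ZMod 2, a ≠ 0 → a = 1 := by decide
  split_ifs with h
  · norm_num [rademacher, h]
  · norm_num [rademacher, eq_one _ h, ZMod.val_one]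

theorem sum_walsh_two_pow (n : ℕ) (x : G) :
    ∑ k ∈ Finset.range (2 ^ n), walsh k x = (dyadicInterval n 0).indicator (fun _ => 2 ^ n) x := by
  induction n with
  | zero => simp [dyadicInterval, walsh_zero]
  | succ n ih =>
    have h_mem : x ∈ dyadicInterval (n + 1) 0 ↔ x ∈ dyadicInterval n 0 ∧ x n = 0 :=
      Nat.forall_lt_succ_right
    calc ∑ k ∈ Finset.range (2 ^ (n + 1)), walsh k x
        = (1 + rademacher n x) * ∑ k ∈ Finset.range (2 ^ n), walsh k x := by
          rw [pow_succ, mul_two, Finset.sum_range_add, add_mul, one_mul, Finset.mul_sum]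
          congr 1
          refine Finset.sum_congr rfl fun l hl => ?_
          rw [walsh_add dvd_rfl (Finset.mem_range.1 hl), walsh_two_pow]
      _ = _ := by
          classical
          rw [ih, one_add_rademacher]
          simp only [Set.indicator_apply, h_mem]
          by_cases h₁ : x ∈ dyadicInterval n 0 <;> by_cases h₂ : x n = 0 <;>
            simp [h₁, h₂, pow_succ']

theorem add_mem_dyadicInterval_zero {n : ℕ} {x y : G} :
    x + y ∈ dyadicInterval n 0 ↔ y ∈ dyadicInterval n x := by
  have add_eq_zero_iff : ∀ a b : ZMod 2, a + b = 0 ↔ b = a := by decide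
  simp only [dyadicInterval, Set.mem_ofPred_eq, Pi.add_apply, Pi.zero_apply, add_eq_zero_iff]

/-! ### Partial sums and Fejér sums of Walsh series -/

section WalshSeries

variable {E : Type*} [NormedAddCommGroup E] [NormedSpace ℝ E]

/-- The partial sum of the first `n` terms of the Walsh series with coefficients `c`. -/
def walshSum (c : ℕ → E) (n : ℕ) (x : G) : E :=
  ∑ k ∈ Finset.range n, walsh k x • c k

/-- The sum of the partial sums of orders `1, …, n` of the Walsh series with coefficients `c`,
that is, `n` times its `n`-th Fejér mean. -/
def fejerSum (c : ℕ → E) (n : ℕ) (x : G) : E :=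
  ∑ j ∈ Finset.range n, walshSum c (j + 1) x

theorem walshSum_add (c : ℕ → E) {N m i : ℕ} (hN : 2 ^ m ∣ N) (hi : i ≤ 2 ^ m) (x : G) :
    walshSum c (N + i) x = walshSum c N x + walsh N x • walshSum (fun l => c (N + l)) i x := by
  simp only [walshSum, Finset.sum_range_add, Finset.smul_sum]
  congr 1
  refine Finset.sum_congr rfl fun l hl => ?_
  rw [walsh_add hN ((Finset.mem_range.1 hl).trans_le hi), mul_smul]

theorem fejerSum_add (c : ℕ → E) {N m i : ℕ} (hN : 2 ^ m ∣ N) (hi : i ≤ 2 ^ m) (x : G) :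
    fejerSum c (N + i) x =
      fejerSum c N x + i • walshSum c N x + walsh N x • fejerSum (fun l => c (N + l)) i x := by
  have h_block : ∀ l ∈ Finset.range i, walshSum c (N + l + 1) x =
      walshSum c N x + walsh N x • walshSum (fun l => c (N + l)) (l + 1) x := fun l hl => by
    rw [add_assoc, walshSum_add c hN ((Finset.mem_range.1 hl).trans_le hi)]
  rw [fejerSum, Finset.sum_range_add, Finset.sum_congr rfl h_block, Finset.sum_add_distrib,
    Finset.sum_const, Finset.card_range, ← Finset.smul_sum, ← add_assoc]
  rfl

theorem fejerSum_eq_sum (c : ℕ → E) (n : ℕ) (x : G) :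
    fejerSum c n x = ∑ k ∈ Finset.range n, ((n : ℝ) - k) • walsh k x • c k := by
  induction n with
  | zero => simp [fejerSum]
  | succ n ih =>
    rw [fejerSum, Finset.sum_range_succ, ← fejerSum, ih, walshSum, Finset.sum_range_succ,
      Finset.sum_range_succ _ n, ← add_assoc, ← Finset.sum_add_distrib]
    push_cast
    congr 1
    · exact Finset.sum_congr rfl fun k _ => by module
    · module

theorem sum_two_pow_mul_testBit {k s : ℕ} (hk : k < 2 ^ s) :
    ∑ t ∈ Finset.range s, 2 ^ t * (k.testBit t).toNat = k := by
  induction s generalizing k with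
  | zero => simp_all
  | succ s ih =>
    have ih_half := ih (k := k / 2) (by rw [pow_succ] at hk; omega)
    rw [Finset.sum_range_succ']
    simp only [Nat.testBit_succ, pow_succ', mul_assoc, ← Finset.mul_sum, ih_half]
    rw [pow_zero, one_mul, Nat.testBit_zero]
    rcases Nat.mod_two_eq_zero_or_one k with h | h <;> simp [h] <;> omega

theorem sum_two_pow_mul_walsh_single {k s : ℕ} (hk : k < 2 ^ s) :
    ∑ t ∈ Finset.range s, (2 : ℝ) ^ t * walsh k (Pi.single t 1) = 2 ^ s - 1 - 2 * k := by
  have h_digits : ∑ t ∈ Finset.range s, (2 : ℝ) ^ t * (k.testBit t).toNat = k := by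
    exact_mod_cast sum_two_pow_mul_testBit hk
  have h_geom : ∑ t ∈ Finset.range s, (2 : ℝ) ^ t = 2 ^ s - 1 := by
    rw [geom_sum_eq (by norm_num)]
    norm_num
  calc _ = ∑ t ∈ Finset.range s, ((2 : ℝ) ^ t - 2 * (2 ^ t * (k.testBit t).toNat)) :=
        Finset.sum_congr rfl fun t _ => by rw [walsh_single]; ring
    _ = _ := by rw [Finset.sum_sub_distrib, ← Finset.mul_sum, h_digits, h_geom]

theorem walshSum_add_single (c : ℕ → E) {n t : ℕ} (hn : n ≤ 2 ^ t) (x : G) :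
    walshSum c n (x + Pi.single t 1) = walshSum c n x := by
  refine Finset.sum_congr rfl fun k hk => ?_
  have h_digit : k.testBit t = false :=
    Nat.testBit_lt_two_pow ((Finset.mem_range.1 hk).trans_le hn)
  simp [walsh_apply_add, walsh_single, h_digit]

theorem two_smul_fejerSum_two_pow (c : ℕ → E) (s : ℕ) (x : G) :
    (2 : ℝ) • fejerSum c (2 ^ s) x =
      ∑ t ∈ Finset.range (s + 1), (2 : ℝ) ^ t • walshSum c (2 ^ s) (x + Pi.single t 1) +
        walshSum c (2 ^ s) x := by
  have h_translates :
      ∑ t ∈ Finset.range (s + 1), (2 : ℝ) ^ t • walshSum c (2 ^ s) (x + Pi.single t 1) =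
        ∑ k ∈ Finset.range (2 ^ s), ((2 : ℝ) ^ (s + 1) - 1 - 2 * k) • walsh k x • c k := by
    simp only [walshSum, Finset.smul_sum]
    rw [Finset.sum_comm]
    refine Finset.sum_congr rfl fun k hk => ?_
    have hk : k < 2 ^ (s + 1) := (Finset.mem_range.1 hk).trans (Nat.pow_lt_pow_succ one_lt_two)
    rw [← sum_two_pow_mul_walsh_single hk, Finset.sum_smul]
    exact Finset.sum_congr rfl fun t _ => by rw [walsh_apply_add]; module
  rw [h_translates, fejerSum_eq_sum, walshSum, Finset.smul_sum, ← Finset.sum_add_distrib]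
  refine Finset.sum_congr rfl fun k _ => ?_
  push_cast
  rw [pow_succ]
  module

theorem two_pow_mul_enorm_walshSum_le (c : ℕ → E) (s : ℕ) (x : G) :
    2 ^ s * ‖walshSum c (2 ^ s) x‖ₑ ≤
      ∑ t ∈ Finset.range (s + 1), 2 ^ t * ‖walshSum c (2 ^ s) (x + Pi.single t 1)‖ₑ := by
  calc 2 ^ s * ‖walshSum c (2 ^ s) x‖ₑ
      = 2 ^ s * ‖walshSum c (2 ^ s) (x + Pi.single s 1)‖ₑ := by rw [walshSum_add_single c le_rfl]
    _ ≤ _ := Finset.single_le_sum_of_canonicallyOrdered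
        (f := fun t => 2 ^ t * ‖walshSum c (2 ^ s) (x + Pi.single t 1)‖ₑ)
        (Finset.self_mem_range_succ s)

theorem enorm_fejerSum_two_pow_le (c : ℕ → E) (s : ℕ) (x : G) :
    ‖fejerSum c (2 ^ s) x‖ₑ ≤
      ∑ t ∈ Finset.range (s + 1), 2 ^ t * ‖walshSum c (2 ^ s) (x + Pi.single t 1)‖ₑ := by
  set S := ∑ t ∈ Finset.range (s + 1), 2 ^ t * ‖walshSum c (2 ^ s) (x + Pi.single t 1)‖ₑ
  have enorm_two : ‖(2 : ℝ)‖ₑ = 2 := by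
    rw [Real.enorm_eq_ofReal two_pos.le, ENNReal.ofReal_ofNat]
  have h_translates :
      ‖∑ t ∈ Finset.range (s + 1), (2 : ℝ) ^ t • walshSum c (2 ^ s) (x + Pi.single t 1)‖ₑ ≤ S :=
    (enorm_sum_le _ _).trans_eq (by simp only [enorm_smul, enorm_pow, enorm_two, S])
  have h_last : ‖walshSum c (2 ^ s) x‖ₑ ≤ S :=
    (le_mul_of_one_le_left zero_le (one_le_pow₀ one_le_two)).trans
      (two_pow_mul_enorm_walshSum_le c s x)
  refine (ENNReal.mul_le_mul_iff_right two_ne_zero ENNReal.ofNat_ne_top).1 ?_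
  calc 2 * ‖fejerSum c (2 ^ s) x‖ₑ = ‖(2 : ℝ) • fejerSum c (2 ^ s) x‖ₑ := by
        rw [enorm_smul, enorm_two]
    _ ≤ S + S := by
        rw [two_smul_fejerSum_two_pow]
        exact (enorm_add_le _ _).trans (add_le_add h_translates h_last)
    _ = 2 * S := (two_mul _).symm

theorem enorm_walsh (n : ℕ) (x : G) : ‖walsh n x‖ₑ = 1 := by
  have norm_walsh : ‖walsh n x‖ = 1 := by simp [walsh, rademacher, norm_prod]
  rw [← ofReal_norm, norm_walsh, ENNReal.ofReal_one]

/-- Splitting off the binary digits of `∑ a ∈ s, 2 ^ a` from the top, the digit `a` contributes a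
dyadic block of frequencies that starts at a multiple `N` of `2 ^ a`. -/
theorem enorm_fejerSum_sum_two_pow_le (s : Finset ℕ) {c : ℕ → E} {u : ℕ → ℝ≥0∞} (x : G)
    (h : ∀ a ∈ s, ∀ N, 2 ^ a ∣ N → N + 2 ^ a ≤ ∑ b ∈ s, 2 ^ b →
      ‖fejerSum (fun l => c (N + l)) (2 ^ a) x‖ₑ +
        2 ^ a * ‖walshSum (fun l => c (N + l)) (2 ^ a) x‖ₑ ≤ u a) :
    ‖fejerSum c (∑ a ∈ s, 2 ^ a) x‖ₑ ≤ ∑ a ∈ s, u a := by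
  induction s using Finset.induction_on_max generalizing c with
  | empty => simp [fejerSum]
  | insert a s ha ih =>
    have ha_notMem : a ∉ s := fun has => (ha a has).false
    rw [Finset.sum_insert ha_notMem] at h
    rw [Finset.sum_insert ha_notMem, Finset.sum_insert ha_notMem]
    set M := ∑ b ∈ s, 2 ^ b
    have hM : M ≤ 2 ^ a := (Nat.geomSum_lt le_rfl ha).le
    have h_top : ‖fejerSum c (2 ^ a) x‖ₑ + 2 ^ a * ‖walshSum c (2 ^ a) x‖ₑ ≤ u a := by
      simpa using h a (Finset.mem_insert_self a s) 0 (dvd_zero _) (by simp)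
    have h_rest : ‖fejerSum (fun l => c (2 ^ a + l)) M x‖ₑ ≤ ∑ b ∈ s, u b := by
      refine ih fun b hb N hN hNM => ?_
      simpa only [add_assoc] using h b (Finset.mem_insert_of_mem hb) (2 ^ a + N)
        (dvd_add (pow_dvd_pow 2 (ha b hb).le) hN) (by omega)
    calc ‖fejerSum c (2 ^ a + M) x‖ₑ
        ≤ ‖fejerSum c (2 ^ a) x‖ₑ + ‖M • walshSum c (2 ^ a) x‖ₑ +
            ‖walsh (2 ^ a) x • fejerSum (fun l => c (2 ^ a + l)) M x‖ₑ := by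
          rw [fejerSum_add c dvd_rfl hM]
          exact enorm_add₃_le
      _ ≤ ‖fejerSum c (2 ^ a) x‖ₑ + 2 ^ a * ‖walshSum c (2 ^ a) x‖ₑ +
            ‖fejerSum (fun l => c (2 ^ a + l)) M x‖ₑ := by
          rw [← Nat.cast_smul_eq_nsmul ℝ, enorm_smul, enorm_smul, enorm_walsh, one_mul,
            Real.enorm_natCast]
          gcongr
          exact_mod_cast hM
      _ ≤ u a + ∑ b ∈ s, u b := add_le_add h_top h_rest

end WalshSeries

/-! ### Weighted sums of translates -/

/-- The number `2 ^ (-1/2)`, the ratio of the geometric weights in all the estimates below. -/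
noncomputable def theta : ℝ≥0∞ := (NNReal.sqrt 2⁻¹ : ℝ≥0)

theorem two_mul_theta_sq : 2 * theta ^ 2 = 1 := by
  rw [theta, ← ENNReal.coe_pow, NNReal.sq_sqrt]
  norm_cast
  exact mul_inv_cancel₀ two_ne_zero

theorem two_pow_mul_theta_pow (n : ℕ) : 2 ^ n * theta ^ (2 * n) = 1 := by
  rw [pow_mul, ← mul_pow, two_mul_theta_sq, one_pow]

theorem theta_le : theta ≤ (3 / 4 : ℝ≥0) := by
  refine ENNReal.coe_le_coe.2 ((NNReal.sqrt_le_iff_le_sq).2 ?_)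
  norm_num [← NNReal.coe_le_coe]

theorem theta_le_one : theta ≤ 1 :=
  theta_le.trans (ENNReal.coe_le_one_iff.2 (by norm_num [← NNReal.coe_le_coe]))

theorem tsum_theta_pow_le : ∑' n, theta ^ n ≤ 4 := by
  have h_gap : (4 : ℝ≥0∞)⁻¹ ≤ 1 - theta := by
    refine le_trans ?_ (tsub_le_tsub_left theta_le 1)
    rw [← ENNReal.coe_one, ← ENNReal.coe_sub, ← ENNReal.coe_ofNat, ← ENNReal.coe_inv four_ne_zero,
      ENNReal.coe_le_coe, le_tsub_iff_right (by norm_num [← NNReal.coe_le_coe])]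
    norm_num [← NNReal.coe_le_coe]
  rw [ENNReal.tsum_geometric]
  exact ENNReal.inv_le_iff_inv_le.1 h_gap

theorem sum_theta_pow_sub_le (k : ℕ) : ∑ t ∈ Finset.range (k + 1), theta ^ (k - t) ≤ 4 := by
  rw [Finset.sum_flip fun t => theta ^ t]
  exact (ENNReal.sum_le_tsum _).trans tsum_theta_pow_le

instance : Measure.IsAddRightInvariant muZ2 := by
  unfold muZ2; infer_instance

instance : Measure.IsAddRightInvariant mu where
  map_add_right_eq_self a := by
    have h := Measure.infinitePi_map_pi (μ := fun _ : ℕ => muZ2) (f := fun j z => z + a j)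
      fun j => measurable_add_const (a j)
    simp only [map_add_right_eq_self] at h
    exact h

/-- The sum of translates `∑ t ≤ k, 2 ^ ((t - k) / 2) h(x + e_t)`. The squares of its weights are
those of the translates of `S_(2 ^ k)` in the Fejér mean of order `2 ^ k`, up to a factor `2`. -/
noncomputable def translateSum (k : ℕ) (h : G → ℝ≥0∞) (x : G) : ℝ≥0∞ :=
  ∑ t ∈ Finset.range (k + 1), theta ^ (k - t) * h (x + Pi.single t 1)

theorem translateSum_add (k : ℕ) (g h : G → ℝ≥0∞) (x : G) :
    translateSum k (fun y => g y + h y) x = translateSum k g x + translateSum k h x := by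
  simp only [translateSum, mul_add, Finset.sum_add_distrib]

theorem measurable_translateSum (k : ℕ) {h : G → ℝ≥0∞} (hh : Measurable h) :
    Measurable (translateSum k h) :=
  Finset.measurable_fun_sum _ fun _ _ => (hh.comp (measurable_add_const _)).const_mul _

theorem lintegral_translateSum_le (k : ℕ) {h : G → ℝ≥0∞} (hh : Measurable h) :
    ∫⁻ x, translateSum k h x ∂mu ≤ 4 * ∫⁻ x, h x ∂mu := by
  have h_meas : ∀ t, Measurable fun x : G => h (x + Pi.single t 1) := fun t =>
    hh.comp (measurable_add_const _)
  calc ∫⁻ x, translateSum k h x ∂mu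
      = ∑ t ∈ Finset.range (k + 1), theta ^ (k - t) * ∫⁻ x, h x ∂mu := by
        simp only [translateSum]
        rw [lintegral_finsetSum _ fun t _ => (h_meas t).const_mul _]
        simp only [lintegral_const_mul _ (h_meas _), lintegral_add_right_eq_self]
    _ = (∑ t ∈ Finset.range (k + 1), theta ^ (k - t)) * ∫⁻ x, h x ∂mu :=
        (Finset.sum_mul _ _ _).symm
    _ ≤ 4 * ∫⁻ x, h x ∂mu := by
        gcongr
        exact sum_theta_pow_sub_le k

theorem theta_pow_mul_sum_le_sq_translateSum {f u : G → ℝ≥0∞} {j : ℕ}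
    (h : ∀ y, theta ^ (2 * j) * f y ≤ u y ^ 2) (k : ℕ) (x : G) :
    theta ^ (2 * (j + k)) * ∑ t ∈ Finset.range (k + 1), 2 ^ t * f (x + Pi.single t 1) ≤
      translateSum k u x ^ 2 := by
  have h_weight : ∀ t ≤ k, theta ^ (2 * k) * 2 ^ t = (theta ^ (k - t)) ^ 2 := fun t ht => by
    obtain ⟨i, rfl⟩ := Nat.exists_eq_add_of_le ht
    calc theta ^ (2 * (t + i)) * 2 ^ t = 2 ^ t * theta ^ (2 * t) * (theta ^ i) ^ 2 := by ring
      _ = (theta ^ (t + i - t)) ^ 2 := by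
        rw [two_pow_mul_theta_pow, one_mul, Nat.add_sub_cancel_left]
  calc _ = ∑ t ∈ Finset.range (k + 1),
        theta ^ (2 * k) * 2 ^ t * (theta ^ (2 * j) * f (x + Pi.single t 1)) := by
        rw [Finset.mul_sum]
        exact Finset.sum_congr rfl fun t _ => by ring
    _ ≤ ∑ t ∈ Finset.range (k + 1), (theta ^ (k - t) * u (x + Pi.single t 1)) ^ 2 := by
        refine Finset.sum_le_sum fun t ht => ?_
        rw [h_weight t (Finset.mem_range_succ_iff.1 ht), mul_pow]
        gcongr
        exact h _
    _ ≤ translateSum k u x ^ 2 := Finset.sum_sq_le_sq_sum_of_nonneg fun _ _ => zero_le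

/-! ### Averages over dyadic intervals -/

theorem mem_dyadicInterval_comm {n : ℕ} {x y : G} :
    y ∈ dyadicInterval n x ↔ x ∈ dyadicInterval n y :=
  forall₂_congr fun _ _ => eq_comm

theorem dyadicInterval_subset {m n : ℕ} (hmn : m ≤ n) {x y : G} (hy : y ∈ dyadicInterval m x) :
    dyadicInterval n y ⊆ dyadicInterval m x :=
  fun _ hz j hj => (hz j (hj.trans_le hmn)).trans (hy j hj)

theorem add_single_mem_dyadicInterval (t : ℕ) (x : G) :
    x + Pi.single t 1 ∈ dyadicInterval t x :=
  fun j hj => by simp [hj.ne]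

theorem mu_dyadicInterval (n : ℕ) (x : G) : mu (dyadicInterval n x) = 2⁻¹ ^ n := by
  have h_pi : dyadicInterval n x = Set.pi (Finset.range n : Set ℕ) fun j => {x j} := by
    ext y; simp [dyadicInterval]
  rw [h_pi, mu, Measure.infinitePi_pi _ fun j _ => measurableSet_singleton _]
  simp [muZ2]

instance (n : ℕ) (x : G) : IsProbabilityMeasure mu[|dyadicInterval n x] :=
  cond_isProbabilityMeasure (by simp [mu_dyadicInterval])

theorem ae_cond_mem_dyadicInterval (n : ℕ) (x : G) :
    ∀ᵐ y ∂mu[|dyadicInterval n x], y ∈ dyadicInterval n x :=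
  ae_cond_mem (measurableSet_dyadicInterval n x)

theorem eq_of_mem_dyadicInterval {β : Type*} [MeasurableSpace β] [MeasurableSingletonClass β]
    {n : ℕ} {f : G → β} (hf : Measurable[dyadicFiltration n] f) {x y : G}
    (hy : y ∈ dyadicInterval n x) : f y = f x := by
  have not_separated : ∀ s : Set G, MeasurableSet[dyadicFiltration n] s → (x ∈ s ↔ y ∈ s) := by
    refine MeasurableSpace.generateFrom_induction _ _ ?_ ?_ ?_ ?_
    · rintro _ ⟨z, rfl⟩ -
      refine forall₂_congr fun j hj => ?_
      rw [hy j hj]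
    · simp
    · intro s _ hs
      simp [hs]
    · intro s _ hs
      simp [hs]
  exact (not_separated _ (hf (measurableSet_singleton (f x)))).1 rfl

/-- The average of `h` over the dyadic interval `I_m(x)`. -/
noncomputable def dyadicAverage (m : ℕ) (h : G → ℝ≥0∞) (x : G) : ℝ≥0∞ :=
  ∫⁻ y, h y ∂mu[|dyadicInterval m x]

theorem dyadicAverage_eq (m : ℕ) (h : G → ℝ≥0∞) (x : G) :
    dyadicAverage m h x = 2 ^ m * ∫⁻ y in dyadicInterval m x, h y ∂mu := by
  rw [dyadicAverage, ProbabilityTheory.cond, lintegral_smul_measure, mu_dyadicInterval,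
    ENNReal.inv_pow, inv_inv, smul_eq_mul]

theorem dyadicAverage_eq_lintegral_indicator (m : ℕ) (h : G → ℝ≥0∞) (x : G) :
    dyadicAverage m h x =
      2 ^ m * ∫⁻ y, {p : G × G | p.2 ∈ dyadicInterval m p.1}.indicator (fun p => h p.2) (x, y)
        ∂mu := by
  rw [dyadicAverage_eq, ← lintegral_indicator (measurableSet_dyadicInterval m x)]
  rfl

theorem measurable_indicator_mem_dyadicInterval (m : ℕ) {h : G → ℝ≥0∞} (hh : Measurable h) :
    Measurable ({p : G × G | p.2 ∈ dyadicInterval m p.1}.indicator fun p => h p.2) := by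
  refine (hh.comp measurable_snd).indicator ?_
  have h_inter : {p : G × G | p.2 ∈ dyadicInterval m p.1} =
      ⋂ j ∈ Finset.range m, {p | p.2 j = p.1 j} := by
    ext p; simp [dyadicInterval]
  rw [h_inter]
  exact Finset.measurableSet_biInter _ fun j _ => measurableSet_eq_fun
    ((measurable_pi_apply j).comp measurable_snd) ((measurable_pi_apply j).comp measurable_fst)

theorem measurable_dyadicAverage (m : ℕ) {h : G → ℝ≥0∞} (hh : Measurable h) :
    Measurable (dyadicAverage m h) := by
  rw [funext (dyadicAverage_eq_lintegral_indicator m h)]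
  exact (measurable_indicator_mem_dyadicInterval m hh).lintegral_prod_right'.const_mul _

theorem lintegral_dyadicAverage (m : ℕ) {h : G → ℝ≥0∞} (hh : Measurable h) :
    ∫⁻ x, dyadicAverage m h x ∂mu = ∫⁻ x, h x ∂mu := by
  have h_meas := measurable_indicator_mem_dyadicInterval m hh
  have h_inner : ∀ y, ∫⁻ x, {p : G × G | p.2 ∈ dyadicInterval m p.1}.indicator
      (fun p => h p.2) (x, y) ∂mu = h y * 2⁻¹ ^ m := fun y => by
    rw [← mu_dyadicInterval m y,
      ← lintegral_indicator_const (measurableSet_dyadicInterval m y) (h y)]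
    congr 1 with x
    classical
    simp only [Set.indicator_apply, Set.mem_ofPred_eq, mem_dyadicInterval_comm (x := x)]
  simp only [dyadicAverage_eq_lintegral_indicator]
  rw [lintegral_const_mul _ h_meas.lintegral_prod_right',
    lintegral_lintegral_swap (f := fun x y => {p : G × G | p.2 ∈ dyadicInterval m p.1}.indicator
      (fun p => h p.2) (x, y)) h_meas.aemeasurable]
  simp only [h_inner]
  rw [lintegral_mul_const _ hh, mul_left_comm, ← mul_pow,
    ENNReal.mul_inv_cancel two_ne_zero ENNReal.ofNat_ne_top, one_pow, mul_one]

theorem dyadicAverage_eq_self {m : ℕ} {h : G → ℝ≥0∞} (hh : Measurable[dyadicFiltration m] h)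
    (x : G) : dyadicAverage m h x = h x := by
  have h_const : ∀ᵐ y ∂mu[|dyadicInterval m x], h y = h x := by
    filter_upwards [ae_cond_mem_dyadicInterval m x] with y hy
    exact eq_of_mem_dyadicInterval hh hy
  rw [dyadicAverage, lintegral_congr_ae h_const, lintegral_const, measure_univ, mul_one]

theorem le_two_pow_mul_dyadicAverage {m n : ℕ} (hmn : m ≤ n) {h : G → ℝ≥0∞}
    (hh : Measurable[dyadicFiltration n] h) {x y : G} (hy : y ∈ dyadicInterval m x) :
    h y ≤ 2 ^ (n - m) * dyadicAverage m h x := by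
  calc h y = dyadicAverage n h y := (dyadicAverage_eq_self hh y).symm
    _ ≤ 2 ^ n * ∫⁻ z in dyadicInterval m x, h z ∂mu := by
        rw [dyadicAverage_eq]
        gcongr
        exact dyadicInterval_subset hmn hy
    _ = 2 ^ (n - m) * dyadicAverage m h x := by
        rw [dyadicAverage_eq, ← mul_assoc, ← pow_add, Nat.sub_add_cancel hmn]

theorem eLpNorm_two_sq {α : Type*} [MeasurableSpace α] (μ : Measure α) (h : α → ℝ≥0∞) :
    eLpNorm h 2 μ ^ 2 = ∫⁻ x, h x ^ 2 ∂μ := by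
  simpa using eLpNorm_nnreal_pow_eq_lintegral (f := h) (μ := μ) (two_ne_zero (α := ℝ≥0))

/-- A Nikolskii inequality: on `I_m(x)` the function `h` is constant on the intervals of level `n`,
hence at most `2 ^ (n - m)` times its average. -/
theorem theta_pow_mul_eLpNorm_two_le_dyadicAverage {m n : ℕ} (hmn : m ≤ n) {h : G → ℝ≥0∞}
    (hh : Measurable[dyadicFiltration n] h) (x : G) :
    theta ^ (n - m) * eLpNorm h 2 mu[|dyadicInterval m x] ≤ dyadicAverage m h x := by
  set A := dyadicAverage m h x
  have h_sq : ∫⁻ y, h y ^ 2 ∂mu[|dyadicInterval m x] ≤ 2 ^ (n - m) * A ^ 2 := by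
    calc ∫⁻ y, h y ^ 2 ∂mu[|dyadicInterval m x]
        ≤ ∫⁻ y, 2 ^ (n - m) * A * h y ∂mu[|dyadicInterval m x] := by
          refine lintegral_mono_ae ?_
          filter_upwards [ae_cond_mem_dyadicInterval m x] with y hy
          rw [sq]
          gcongr
          exact le_two_pow_mul_dyadicAverage hmn hh hy
      _ = 2 ^ (n - m) * A * A :=
          lintegral_const_mul _ (hh.mono (dyadicFiltration.le n) le_rfl)
      _ = 2 ^ (n - m) * A ^ 2 := by ring
  refine (ENNReal.pow_le_pow_left_iff two_ne_zero).1 ?_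
  calc (theta ^ (n - m) * eLpNorm h 2 mu[|dyadicInterval m x]) ^ 2
      ≤ theta ^ (2 * (n - m)) * (2 ^ (n - m) * A ^ 2) := by
        rw [mul_pow, ← pow_mul, mul_comm (n - m), eLpNorm_two_sq]
        gcongr
    _ = A ^ 2 := by rw [← mul_assoc, mul_comm (theta ^ _), two_pow_mul_theta_pow, one_mul]

/-! ### Increasing adapted sequences -/

/-- The increments of a sequence of functions. For an increasing sequence the truncated subtraction
is a genuine one. -/
noncomputable def increment (b : ℕ → G → ℝ≥0∞) (n : ℕ) (x : G) : ℝ≥0∞ :=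
  b (n + 1) x - b n x

/-- The sum of the weighted translates of all increments of `b`. -/
noncomputable def incrementTranslateSum (b : ℕ → G → ℝ≥0∞) (x : G) : ℝ≥0∞ :=
  ∑' j, translateSum j (increment b j) x

/-- A bound, by `theta_pow_mul_eLpNorm_two_le_add_remainder`, for the excess over `b m` of the
`L²`-means of `b (n + 1)` on the dyadic intervals of level `m`, weighted by
`2 ^ ((m - n - 1) / 2)`. -/
noncomputable def remainder (b : ℕ → G → ℝ≥0∞) (m n : ℕ) (x : G) : ℝ≥0∞ :=
  ∑ j ∈ Finset.Icc m n, theta ^ (n - j) * dyadicAverage m (increment b j) x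

/-- A pointwise bound for the sums of the weighted translates of `b a` and of the remainders of
order `k` over any set of levels `a ∈ A k`, when `b ≤ B` and each `A k` has at most `r` elements. -/
noncomputable def majorant (b : ℕ → G → ℝ≥0∞) (B : G → ℝ≥0∞) (r : ℕ) (A : ℕ → Finset ℕ) (x : G) :
    ℝ≥0∞ :=
  r * (4 * B x + incrementTranslateSum b x) +
    ∑' k, ∑ a ∈ A k, translateSum a (remainder b a k) x

theorem add_sum_increment_eq {b : ℕ → G → ℝ≥0∞} (hb : Monotone b) {m n : ℕ} (hmn : m ≤ n) (x : G) :
    b m x + ∑ j ∈ Finset.Ico m n, increment b j x = b n x := by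
  induction n, hmn using Nat.le_induction with
  | base => simp
  | succ n hmn ih =>
    rw [Finset.sum_Ico_succ_top hmn, ← add_assoc, ih]
    exact add_tsub_cancel_of_le (hb n.le_succ x)

theorem tsum_sum_mul_sub_eq (f g : ℕ → ℝ≥0∞) :
    ∑' n, ∑ j ∈ Finset.range (n + 1), f (n - j) * g j = (∑' n, f n) * ∑' n, g n := by
  calc ∑' n, ∑ j ∈ Finset.range (n + 1), f (n - j) * g j
      = ∑' (n : ℕ) (p : Finset.HasAntidiagonal.antidiagonal n), f p.1.2 * g p.1.1 := by
        refine tsum_congr fun n => ?_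
        rw [Finset.tsum_subtype (Finset.HasAntidiagonal.antidiagonal n) fun p => f p.2 * g p.1,
          Finset.Nat.sum_antidiagonal_eq_sum_range_succ fun j i => f i * g j]
    _ = ∑' p : ℕ × ℕ, f p.2 * g p.1 := by
        rw [← ENNReal.tsum_sigma' fun q : (n : ℕ) × Finset.HasAntidiagonal.antidiagonal n =>
          f q.2.1.2 * g q.2.1.1]
        exact Finset.HasAntidiagonal.sigmaAntidiagonalEquivProd.tsum_eq fun p => f p.2 * g p.1
    _ = (∑' n, f n) * ∑' n, g n := by
        rw [ENNReal.tsum_prod (f := fun j i => f i * g j)]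
        simp only [ENNReal.tsum_mul_right, ENNReal.tsum_mul_left]

section IncreasingAdapted

variable {b : ℕ → G → ℝ≥0∞}

theorem measurable_dyadicFiltration_increment (hb : Adapted dyadicFiltration b) (n : ℕ) :
    Measurable[dyadicFiltration (n + 1)] (increment b n) :=
  (hb (n + 1)).sub (hb.measurable_le n.le_succ)

theorem measurable_increment (hb : Adapted dyadicFiltration b) (n : ℕ) :
    Measurable (increment b n) :=
  hb.measurable.sub hb.measurable

theorem theta_pow_mul_eLpNorm_two_le_add_remainder (hb : Monotone b)
    (hb_adapted : Adapted dyadicFiltration b) {m n : ℕ} (hmn : m ≤ n) (x : G) :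
    theta ^ (n + 1 - m) * eLpNorm (b (n + 1)) 2 mu[|dyadicInterval m x] ≤
      b m x + remainder b m n x := by
  set ν := mu[|dyadicInterval m x]
  have h_meas := measurable_increment hb_adapted
  have h_base : eLpNorm (b m) 2 ν ≤ b m x := by
    simpa [dyadicAverage_eq_self (hb_adapted m)] using
      theta_pow_mul_eLpNorm_two_le_dyadicAverage le_rfl (hb_adapted m) x
  have h_increment : ∀ j ∈ Finset.Icc m n, theta ^ (n + 1 - m) * eLpNorm (increment b j) 2 ν ≤
      theta ^ (n - j) * dyadicAverage m (increment b j) x := fun j hj => by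
    obtain ⟨hmj, hjn⟩ := Finset.mem_Icc.1 hj
    rw [show n + 1 - m = n - j + (j + 1 - m) by omega, pow_add, mul_assoc]
    gcongr
    exact theta_pow_mul_eLpNorm_two_le_dyadicAverage (hmj.trans j.le_succ)
      (measurable_dyadicFiltration_increment hb_adapted j) x
  have h_telescope : b (n + 1) = b m + ∑ j ∈ Finset.Icc m n, increment b j := by
    ext y
    rw [← add_sum_increment_eq hb (hmn.trans n.le_succ) y]
    rw [Pi.add_apply, Finset.sum_apply, ← Finset.Ico_succ_right_eq_Icc, Nat.succ_eq_succ]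
  calc theta ^ (n + 1 - m) * eLpNorm (b (n + 1)) 2 ν
      ≤ theta ^ (n + 1 - m) * (eLpNorm (b m) 2 ν +
          ∑ j ∈ Finset.Icc m n, eLpNorm (increment b j) 2 ν) := by
        rw [h_telescope]
        gcongr
        refine (eLpNorm_add_le hb_adapted.measurable.aestronglyMeasurable
          (Finset.aestronglyMeasurable_sum _ fun j _ => (h_meas j).aestronglyMeasurable)
          one_le_two).trans ?_
        gcongr
        exact eLpNorm_sum_le (fun j _ => (h_meas j).aestronglyMeasurable) one_le_two
    _ ≤ b m x + remainder b m n x := by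
        rw [mul_add, Finset.mul_sum]
        exact add_le_add (mul_le_of_le_one_of_le (pow_le_one₀ zero_le theta_le_one) h_base)
          (Finset.sum_le_sum h_increment)

theorem tsum_lintegral_increment_le (hb : Monotone b) (hb_adapted : Adapted dyadicFiltration b)
    {B : G → ℝ≥0∞} (hB : ∀ n x, b n x ≤ B x) :
    ∑' n, ∫⁻ x, increment b n x ∂mu ≤ ∫⁻ x, B x ∂mu := by
  rw [← lintegral_tsum fun n => (measurable_increment hb_adapted n).aemeasurable]
  refine lintegral_mono fun x => ENNReal.tsum_le_of_sum_range_le fun n => ?_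
  calc ∑ j ∈ Finset.range n, increment b j x
      ≤ b 0 x + ∑ j ∈ Finset.Ico 0 n, increment b j x := by
        rw [Finset.range_eq_Ico]; exact le_add_self
    _ = b n x := add_sum_increment_eq hb n.zero_le x
    _ ≤ B x := hB n x

theorem translateSum_le (hb : Monotone b) (hb_adapted : Adapted dyadicFiltration b) {x : G}
    {B : ℝ≥0∞} (hB : ∀ n, b n x ≤ B) (k : ℕ) :
    translateSum k (b k) x ≤ 4 * B + incrementTranslateSum b x := by
  have h_summand : ∀ t ∈ Finset.range (k + 1), theta ^ (k - t) * b k (x + Pi.single t 1) ≤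
      theta ^ (k - t) * B +
        ∑ j ∈ Finset.Ico t k, theta ^ (j - t) * increment b j (x + Pi.single t 1) := by
    intro t ht
    rw [← add_sum_increment_eq hb (Finset.mem_range_succ_iff.1 ht),
      eq_of_mem_dyadicInterval (hb_adapted t) (add_single_mem_dyadicInterval t x), mul_add,
      Finset.mul_sum]
    refine add_le_add (mul_le_mul_right (hB t) _) (Finset.sum_le_sum fun j hj => ?_)
    refine mul_le_mul_left (pow_le_pow_of_le_one zero_le theta_le_one ?_) _
    exact Nat.sub_le_sub_right (Finset.mem_Ico.1 hj).2.le t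
  calc translateSum k (b k) x
      ≤ ∑ t ∈ Finset.range (k + 1), (theta ^ (k - t) * B +
          ∑ j ∈ Finset.Ico t k, theta ^ (j - t) * increment b j (x + Pi.single t 1)) :=
        Finset.sum_le_sum h_summand
    _ = (∑ t ∈ Finset.range (k + 1), theta ^ (k - t)) * B +
          ∑ j ∈ Finset.range k, translateSum j (increment b j) x := by
        rw [Finset.sum_add_distrib, Finset.sum_mul]
        congr 1
        refine Finset.sum_comm' fun t j => ?_
        simp only [Finset.mem_range, Finset.mem_Ico]
        omega
    _ ≤ 4 * B + incrementTranslateSum b x :=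
        add_le_add (mul_le_mul_left (sum_theta_pow_sub_le k) B) (ENNReal.sum_le_tsum _)

theorem measurable_incrementTranslateSum (hb : Adapted dyadicFiltration b) :
    Measurable (incrementTranslateSum b) :=
  Measurable.tsum fun n => measurable_translateSum n (measurable_increment hb n)

theorem lintegral_incrementTranslateSum_le (hb : Monotone b)
    (hb_adapted : Adapted dyadicFiltration b) {B : G → ℝ≥0∞} (hB : ∀ n x, b n x ≤ B x) :
    ∫⁻ x, incrementTranslateSum b x ∂mu ≤ 4 * ∫⁻ x, B x ∂mu := by
  have h_meas := measurable_increment hb_adapted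
  calc ∫⁻ x, incrementTranslateSum b x ∂mu
      = ∑' n, ∫⁻ x, translateSum n (increment b n) x ∂mu :=
        lintegral_tsum fun n => (measurable_translateSum n (h_meas n)).aemeasurable
    _ ≤ 4 * ∑' n, ∫⁻ x, increment b n x ∂mu := by
        rw [← ENNReal.tsum_mul_left]
        exact ENNReal.tsum_le_tsum fun n => lintegral_translateSum_le n (h_meas n)
    _ ≤ 4 * ∫⁻ x, B x ∂mu := by
        gcongr
        exact tsum_lintegral_increment_le hb hb_adapted hB

theorem measurable_remainder (hb : Adapted dyadicFiltration b) (m n : ℕ) :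
    Measurable (remainder b m n) :=
  Finset.measurable_fun_sum _ fun j _ =>
    (measurable_dyadicAverage m (measurable_increment hb j)).const_mul _

theorem lintegral_remainder_le (hb : Adapted dyadicFiltration b) (m n : ℕ) :
    ∫⁻ x, remainder b m n x ∂mu ≤
      ∑ j ∈ Finset.range (n + 1), theta ^ (n - j) * ∫⁻ x, increment b j x ∂mu := by
  have h_meas := measurable_increment hb
  have h_average : ∀ j, Measurable (dyadicAverage m (increment b j)) := fun j =>
    measurable_dyadicAverage m (h_meas j)
  simp only [remainder]
  rw [lintegral_finsetSum _ fun j _ => (h_average j).const_mul _]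
  simp only [lintegral_const_mul _ (h_average _), lintegral_dyadicAverage m (h_meas _)]
  refine Finset.sum_le_sum_of_subset fun j hj => ?_
  exact Finset.mem_range_succ_iff.2 (Finset.mem_Icc.1 hj).2

theorem measurable_tsum_translateSum_remainder (hb : Adapted dyadicFiltration b)
    (A : ℕ → Finset ℕ) :
    Measurable fun x => ∑' k, ∑ a ∈ A k, translateSum a (remainder b a k) x :=
  Measurable.tsum fun k => Finset.measurable_fun_sum _ fun a _ =>
    measurable_translateSum a (measurable_remainder hb a k)

theorem lintegral_tsum_translateSum_remainder_le (hb : Monotone b)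
    (hb_adapted : Adapted dyadicFiltration b) {B : G → ℝ≥0∞} (hB : ∀ n x, b n x ≤ B x)
    {r : ℕ} {A : ℕ → Finset ℕ} (hA : ∀ k, (A k).card ≤ r) :
    ∫⁻ x, ∑' k, ∑ a ∈ A k, translateSum a (remainder b a k) x ∂mu ≤
      16 * r * ∫⁻ x, B x ∂mu := by
  set D : ℕ → ℝ≥0∞ := fun j => ∫⁻ x, increment b j x ∂mu
  have h_meas : ∀ a k, Measurable (translateSum a (remainder b a k)) := fun a k =>
    measurable_translateSum a (measurable_remainder hb_adapted a k)
  have h_level : ∀ k, ∫⁻ x, ∑ a ∈ A k, translateSum a (remainder b a k) x ∂mu ≤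
      r * 4 * ∑ j ∈ Finset.range (k + 1), theta ^ (k - j) * D j := fun k => by
    rw [lintegral_finsetSum _ fun a _ => h_meas a k, mul_assoc, ← nsmul_eq_mul]
    refine (Finset.sum_le_card_nsmul _ _ _ fun a _ => ?_).trans (nsmul_le_nsmul_left zero_le (hA k))
    refine (lintegral_translateSum_le a (measurable_remainder hb_adapted a k)).trans ?_
    gcongr
    exact lintegral_remainder_le hb_adapted a k
  calc ∫⁻ x, ∑' k, ∑ a ∈ A k, translateSum a (remainder b a k) x ∂mu
      = ∑' k, ∫⁻ x, ∑ a ∈ A k, translateSum a (remainder b a k) x ∂mu :=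
        lintegral_tsum fun k =>
          (Finset.measurable_fun_sum _ fun a _ => h_meas a k).aemeasurable
    _ ≤ ∑' k, r * 4 * ∑ j ∈ Finset.range (k + 1), theta ^ (k - j) * D j :=
        ENNReal.tsum_le_tsum h_level
    _ = r * 4 * ((∑' n, theta ^ n) * ∑' n, D n) := by
        rw [ENNReal.tsum_mul_left, tsum_sum_mul_sub_eq (theta ^ ·) D]
    _ ≤ r * 4 * (4 * ∫⁻ x, B x ∂mu) := by
        gcongr
        · exact tsum_theta_pow_le
        · exact tsum_lintegral_increment_le hb hb_adapted hB
    _ = 16 * r * ∫⁻ x, B x ∂mu := by ring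

theorem sum_translateSum_le_majorant (hb : Monotone b) (hb_adapted : Adapted dyadicFiltration b)
    {B : G → ℝ≥0∞} (hB : ∀ n x, b n x ≤ B x) {r : ℕ} {A : ℕ → Finset ℕ}
    (hA : ∀ k, (A k).card ≤ r) {D : Finset ℕ} {k : ℕ} (hD : D ⊆ A k) (x : G) :
    ∑ a ∈ D, (translateSum a (b a) x + translateSum a (remainder b a k) x) ≤
      majorant b B r A x := by
  calc _ ≤ ∑ a ∈ A k, (translateSum a (b a) x + translateSum a (remainder b a k) x) :=
        Finset.sum_le_sum_of_subset hD
    _ ≤ (A k).card * (4 * B x + incrementTranslateSum b x) +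
          ∑ a ∈ A k, translateSum a (remainder b a k) x := by
        rw [Finset.sum_add_distrib, ← nsmul_eq_mul]
        gcongr
        exact Finset.sum_le_card_nsmul _ _ _ fun a _ =>
          translateSum_le hb hb_adapted (fun n => hB n x) a
    _ ≤ majorant b B r A x := by
        rw [majorant]
        gcongr
        · exact hA k
        · exact ENNReal.le_tsum (f := fun k => ∑ a ∈ A k, translateSum a (remainder b a k) x) k

theorem lintegral_majorant_le (hb : Monotone b) (hb_adapted : Adapted dyadicFiltration b)
    {B : G → ℝ≥0∞} (hB : ∀ n x, b n x ≤ B x) {r : ℕ} {A : ℕ → Finset ℕ}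
    (hA : ∀ k, (A k).card ≤ r) :
    ∫⁻ x, majorant b B r A x ∂mu ≤ 24 * r * ∫⁻ x, B x ∂mu := by
  simp only [majorant]
  rw [lintegral_add_right _ (measurable_tsum_translateSum_remainder hb_adapted A),
    lintegral_const_mul' _ _ (ENNReal.natCast_ne_top r),
    lintegral_add_right _ (measurable_incrementTranslateSum hb_adapted),
    lintegral_const_mul' _ _ ENNReal.ofNat_ne_top]
  calc _ ≤ r * (4 * ∫⁻ x, B x ∂mu + 4 * ∫⁻ x, B x ∂mu) + 16 * r * ∫⁻ x, B x ∂mu := by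
        gcongr
        · exact lintegral_incrementTranslateSum_le hb hb_adapted hB
        · exact lintegral_tsum_translateSum_remainder_le hb hb_adapted hB hA
    _ = 24 * r * ∫⁻ x, B x ∂mu := by ring

end IncreasingAdapted

/-! ### Dyadic martingales -/

section Martingale

variable {𝕜 : Type*} [RCLike 𝕜] {F : ℕ → G → 𝕜}

theorem integrable_walsh_smul (k : ℕ) {f : G → 𝕜} (hf : Integrable f mu) :
    Integrable (fun x => walsh k x • f x) mu :=
  hf.bdd_smul 1 (measurable_walsh k).aestronglyMeasurable (ae_of_all _ (abs_walsh_le k))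

theorem walshFourierCoeff_eq (hF : Martingale F dyadicFiltration mu) {k n : ℕ} (h : k < 2 ^ n) :
    walshFourierCoeff F k = ∫ x, walsh k x • F n x ∂mu := by
  refine tendsto_nhds_unique (tendsto_walshFourierCoeff hF k) (tendsto_const_nhds.congr' ?_)
  filter_upwards [eventually_ge_atTop n] with m hm
  have h_walsh : StronglyMeasurable[dyadicFiltration n] (walsh k) :=
    (stronglyMeasurable_walsh k).mono (dyadicFiltration.mono (Nat.size_le.2 h))
  have h_pull_out := condExp_smul_of_aestronglyMeasurable_left (μ := mu)
    h_walsh.aestronglyMeasurable (integrable_walsh_smul k (hF.integrable m)) (hF.integrable m)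
  change _ = ∫ x, (walsh k • F m) x ∂mu
  rw [← integral_condExp (f := walsh k • F m) (dyadicFiltration.le n)]
  refine integral_congr_ae ?_
  filter_upwards [h_pull_out, hF.condExp_ae_eq hm] with x hx_pull_out hx_martingale
  rw [hx_pull_out, Pi.smul_apply', hx_martingale]

theorem walshSum_walshFourierCoeff_eq_integral (hF : Martingale F dyadicFiltration mu)
    {N m n : ℕ} (hN : 2 ^ m ∣ N) (hNn : N + 2 ^ m ≤ 2 ^ n) (x : G) :
    walshSum (fun l => walshFourierCoeff F (N + l)) (2 ^ m) x =
      ∫ y, (dyadicInterval m x).indicator (fun _ => (2 : ℝ) ^ m) y • walsh N y • F n y ∂mu := by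
  have h_kernel : ∀ y, (dyadicInterval m x).indicator (fun _ => (2 : ℝ) ^ m) y =
      ∑ l ∈ Finset.range (2 ^ m), walsh l (x + y) := fun y => by
    classical
    simp only [sum_walsh_two_pow, Set.indicator_apply, add_mem_dyadicInterval_zero]
  have h_term : ∀ l ∈ Finset.range (2 ^ m), walsh l x • walshFourierCoeff F (N + l) =
      ∫ y, walsh l x • walsh (N + l) y • F n y ∂mu := fun l hl => by
    rw [walshFourierCoeff_eq hF ((Nat.add_lt_add_left (Finset.mem_range.1 hl) N).trans_le hNn),
      integral_smul]
  rw [walshSum, Finset.sum_congr rfl h_term, ← integral_finsetSum]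
  · refine integral_congr_ae (ae_of_all _ fun y => ?_)
    simp only [h_kernel, Finset.sum_smul]
    refine Finset.sum_congr rfl fun l hl => ?_
    rw [walsh_add hN (Finset.mem_range.1 hl), walsh_apply_add]
    module
  · exact fun l _ => (integrable_walsh_smul (N + l) (hF.integrable n)).smul (walsh l x)

theorem enorm_walshSum_walshFourierCoeff_le (hF : Martingale F dyadicFiltration mu)
    {N m n : ℕ} (hN : 2 ^ m ∣ N) (hNn : N + 2 ^ m ≤ 2 ^ n) (x : G) :
    ‖walshSum (fun l => walshFourierCoeff F (N + l)) (2 ^ m) x‖ₑ ≤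
      dyadicAverage m (fun y => ‖F n y‖ₑ) x := by
  rw [walshSum_walshFourierCoeff_eq_integral hF hN hNn, dyadicAverage_eq,
    ← lintegral_const_mul' _ _ (by finiteness),
    ← lintegral_indicator (measurableSet_dyadicInterval m x)]
  refine (enorm_integral_le_lintegral_enorm _).trans_eq (lintegral_congr fun y => ?_)
  classical
  by_cases hy : y ∈ dyadicInterval m x
  · simp [hy, enorm_smul, enorm_walsh, Real.enorm_eq_ofReal]
  · simp [hy]

/-- The square root of the running maximum `max_{i ≤ n} |F_i|`. -/
noncomputable def sqrtMaximal (F : ℕ → G → 𝕜) (n : ℕ) (x : G) : ℝ≥0∞ :=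
  ⨆ i ∈ Set.Iic n, ‖F i x‖ₑ ^ (1 / 2 : ℝ)

theorem monotone_sqrtMaximal (F : ℕ → G → 𝕜) : Monotone (sqrtMaximal F) :=
  fun _ _ hmn _ => biSup_mono fun _ hi => hi.trans hmn

theorem adapted_sqrtMaximal (hF : Martingale F dyadicFiltration mu) :
    Adapted dyadicFiltration (sqrtMaximal F) := fun _ =>
  Measurable.biSup _ (Set.to_countable _) fun _ hi =>
    (measurable_enorm.pow_const _).comp (hF.stronglyAdapted.stronglyMeasurable_le hi).measurable

theorem sqrtMaximal_le (F : ℕ → G → 𝕜) (n : ℕ) (x : G) :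
    sqrtMaximal F n x ≤ maximalFunction F x ^ (1 / 2 : ℝ) := by
  refine iSup₂_le fun i _ => ?_
  gcongr
  exact le_iSup (fun i => ‖F i x‖ₑ) i

theorem enorm_le_sq_sqrtMaximal (F : ℕ → G → 𝕜) (n : ℕ) (x : G) :
    ‖F n x‖ₑ ≤ sqrtMaximal F n x ^ 2 := by
  calc ‖F n x‖ₑ = (‖F n x‖ₑ ^ (1 / 2 : ℝ)) ^ 2 := by
        rw [← ENNReal.rpow_natCast, ← ENNReal.rpow_mul]
        norm_num
    _ ≤ sqrtMaximal F n x ^ 2 := by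
        gcongr
        exact le_biSup (fun i => ‖F i x‖ₑ ^ (1 / 2 : ℝ)) (Set.self_mem_Iic (a := n))

theorem theta_pow_mul_enorm_walshSum_le_sq (hF : Martingale F dyadicFiltration mu)
    {N m n : ℕ} (hmn : m ≤ n) (hN : 2 ^ m ∣ N) (hNn : N + 2 ^ m ≤ 2 ^ (n + 1)) (x : G) :
    theta ^ (2 * (n + 1 - m)) * ‖walshSum (fun l => walshFourierCoeff F (N + l)) (2 ^ m) x‖ₑ ≤
      (sqrtMaximal F m x + remainder (sqrtMaximal F) m n x) ^ 2 := by
  calc _ ≤ theta ^ (2 * (n + 1 - m)) * dyadicAverage m (fun y => ‖F (n + 1) y‖ₑ) x := by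
        gcongr
        exact enorm_walshSum_walshFourierCoeff_le hF hN hNn x
    _ ≤ theta ^ (2 * (n + 1 - m)) *
          eLpNorm (sqrtMaximal F (n + 1)) 2 mu[|dyadicInterval m x] ^ 2 := by
        rw [eLpNorm_two_sq, dyadicAverage]
        gcongr with y
        exact enorm_le_sq_sqrtMaximal F (n + 1) y
    _ = (theta ^ (n + 1 - m) *
          eLpNorm (sqrtMaximal F (n + 1)) 2 mu[|dyadicInterval m x]) ^ 2 := by
        rw [mul_pow, ← pow_mul, mul_comm 2]
    _ ≤ _ := by
        gcongr
        exact theta_pow_mul_eLpNorm_two_le_add_remainder (monotone_sqrtMaximal F)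
          (adapted_sqrtMaximal hF) hmn x

/-! ### Estimates of Fejér means -/

theorem fejerMean_eq (n : ℕ) (F : ℕ → G → 𝕜) (x : G) :
    fejerMean n F x = (n : 𝕜)⁻¹ * fejerSum (walshFourierCoeff F) n x := by
  rw [fejerMean, fejerSum, Finset.range_eq_Ico, Finset.sum_Ico_add' (fun j => walshSum _ j x)]
  rfl

theorem enorm_inv_natCast_le {n k : ℕ} (h : 2 ^ k ≤ n) : ‖(n : 𝕜)⁻¹‖ₑ ≤ theta ^ (2 * k) := by
  have hn : n ≠ 0 := ((pow_pos two_pos k).trans_le h).ne'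
  have h_theta : theta ^ (2 * k) = (2 ^ k)⁻¹ :=
    ENNReal.eq_inv_of_mul_eq_one_left ((mul_comm _ _).trans (two_pow_mul_theta_pow k))
  rw [h_theta, enorm_inv (Nat.cast_ne_zero.2 hn), ← ofReal_norm, RCLike.norm_natCast,
    ENNReal.ofReal_natCast, ENNReal.inv_le_inv]
  exact_mod_cast h

theorem enorm_fejerSum_add_walshSum_le (hF : Martingale F dyadicFiltration mu)
    {N a k : ℕ} (hak : a ≤ k) (hN : 2 ^ a ∣ N) (hNk : N + 2 ^ a ≤ 2 ^ (k + 1)) (x : G) :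
    ‖fejerSum (fun l => walshFourierCoeff F (N + l)) (2 ^ a) x‖ₑ +
        2 ^ a * ‖walshSum (fun l => walshFourierCoeff F (N + l)) (2 ^ a) x‖ₑ ≤
      2 ^ k * (2 * (translateSum a (sqrtMaximal F a) x +
        translateSum a (remainder (sqrtMaximal F) a k) x)) ^ 2 := by
  set c := fun l => walshFourierCoeff F (N + l)
  set S := ∑ t ∈ Finset.range (a + 1), 2 ^ t * ‖walshSum c (2 ^ a) (x + Pi.single t 1)‖ₑ
  set T := translateSum a (sqrtMaximal F a) x + translateSum a (remainder (sqrtMaximal F) a k) x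
  have h_scaled : theta ^ (2 * (k + 1)) * S ≤ T ^ 2 := by
    have h := theta_pow_mul_sum_le_sq_translateSum
      (theta_pow_mul_enorm_walshSum_le_sq hF hak hN hNk) a x
    rwa [Nat.sub_add_cancel (hak.trans k.le_succ), translateSum_add] at h
  calc _ ≤ S + S :=
        add_le_add (enorm_fejerSum_two_pow_le c a x) (two_pow_mul_enorm_walshSum_le c a x)
    _ = 2 ^ (k + 2) * (theta ^ (2 * (k + 1)) * S) := by
        rw [pow_succ, mul_right_comm, ← mul_assoc (2 ^ (k + 1)), two_pow_mul_theta_pow]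
        ring
    _ ≤ 2 ^ (k + 2) * T ^ 2 := by gcongr
    _ = 2 ^ k * (2 * T) ^ 2 := by ring

theorem enorm_fejerMean_le (hF : Martingale F dyadicFiltration mu) (n : ℕ) (x : G) :
    ‖fejerMean n F x‖ₑ ≤
      (2 * ∑ a ∈ n.bitIndices.toFinset, (translateSum a (sqrtMaximal F a) x +
        translateSum a (remainder (sqrtMaximal F) a (Nat.log 2 n)) x)) ^ 2 := by
  rcases eq_or_ne n 0 with rfl | hn
  · simp [fejerMean]
  set k := Nat.log 2 n
  set D := n.bitIndices.toFinset
  set T : ℕ → ℝ≥0∞ := fun a => translateSum a (sqrtMaximal F a) x +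
    translateSum a (remainder (sqrtMaximal F) a k) x
  have hn_sum : ∑ a ∈ D, 2 ^ a = n := Finset.sum_toFinset_bitIndices_two_pow n
  have hn_lt : n < 2 ^ (k + 1) := Nat.lt_pow_succ_log_self one_lt_two n
  have h_digit_le : ∀ a ∈ D, a ≤ k := fun a ha =>
    Nat.le_log_of_pow_le one_lt_two (Nat.two_pow_le_of_mem_bitIndices (List.mem_toFinset.1 ha))
  have h_fejerSum : ‖fejerSum (walshFourierCoeff F) n x‖ₑ ≤ ∑ a ∈ D, 2 ^ k * (2 * T a) ^ 2 := by
    rw [← hn_sum]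
    refine enorm_fejerSum_sum_two_pow_le D x fun a ha N hN hNn => ?_
    exact enorm_fejerSum_add_walshSum_le hF (h_digit_le a ha) hN
      (hNn.trans (hn_sum.trans_le hn_lt.le)) x
  calc ‖fejerMean n F x‖ₑ ≤ theta ^ (2 * k) * ∑ a ∈ D, 2 ^ k * (2 * T a) ^ 2 := by
        rw [fejerMean_eq, enorm_mul]
        exact mul_le_mul' (enorm_inv_natCast_le (Nat.pow_log_le_self 2 hn)) h_fejerSum
    _ = ∑ a ∈ D, (2 * T a) ^ 2 := by
        rw [← Finset.mul_sum, ← mul_assoc, mul_comm (theta ^ _), two_pow_mul_theta_pow, one_mul]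
    _ ≤ (∑ a ∈ D, 2 * T a) ^ 2 := Finset.sum_sq_le_sq_sum_of_nonneg fun _ _ => zero_le
    _ = (2 * ∑ a ∈ D, T a) ^ 2 := by rw [Finset.mul_sum]

/-! ### Restricted maximal operators -/

theorem eLpNorm_one_half {α : Type*} [MeasurableSpace α] (μ : Measure α) (f : α → ℝ≥0∞) :
    eLpNorm f (1 / 2) μ = (∫⁻ x, f x ^ (1 / 2 : ℝ) ∂μ) ^ 2 := by
  rw [eLpNorm_eq_lintegral_rpow_enorm_toReal (by simp) (by simp)]
  simp only [enorm_eq_self, one_div, ENNReal.toReal_inv, ENNReal.toReal_ofNat, inv_inv]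
  exact ENNReal.rpow_natCast _ 2

theorem measurable_restrictedMaximal (n : ℕ → ℕ) (F : ℕ → G → 𝕜) :
    Measurable (restrictedMaximal n F) :=
  Measurable.iSup fun _ => (Measurable.const_mul (Finset.measurable_fun_sum _ fun _ _ =>
    Finset.measurable_fun_sum _ fun k _ => (measurable_walsh k).smul_const _) _).enorm

theorem boundedHardyLp_of_le_sq {n : ℕ → ℕ} (C : ℝ≥0)
    (h : ∀ F : ℕ → G → 𝕜, Martingale F dyadicFiltration mu → ∃ Z : G → ℝ≥0∞,
      (∀ k x, ‖fejerMean (n k) F x‖ₑ ≤ Z x ^ 2) ∧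
      ∫⁻ x, Z x ∂mu ≤ C * ∫⁻ x, maximalFunction F x ^ (1 / 2 : ℝ) ∂mu) :
    BoundedHardyLp (1 / 2) (restrictedMaximal (𝕜 := 𝕜) n) := by
  refine ⟨C ^ 2, fun F hF => ?_⟩
  obtain ⟨Z, hZ, hZ_lintegral⟩ := h F hF.1
  have h_bound : eLpNorm (restrictedMaximal n F) (1 / 2) mu ≤
      (C ^ 2 : ℝ≥0) * hardyNorm (1 / 2) F := by
    rw [hardyNorm, eLpNorm_one_half, eLpNorm_one_half, ENNReal.coe_pow, ← mul_pow]
    gcongr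
    refine (lintegral_mono fun x => ?_).trans hZ_lintegral
    calc restrictedMaximal n F x ^ (1 / 2 : ℝ) ≤ (Z x ^ 2) ^ (1 / 2 : ℝ) := by
          gcongr
          exact iSup_le fun k => hZ k x
      _ = Z x := by
          rw [← ENNReal.rpow_natCast, ← ENNReal.rpow_mul]
          norm_num
  refine ⟨⟨(measurable_restrictedMaximal n F).aestronglyMeasurable, ?_⟩, h_bound⟩
  exact h_bound.trans_lt (ENNReal.mul_lt_top ENNReal.coe_lt_top hF.2)

end Martingale

theorem mem_pair_of_mem_bitIndices_two_pow_add_two_pow {s : ℕ → ℕ} {k a : ℕ} (hs : s k ≤ k)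
    (ha : a ∈ (2 ^ k + 2 ^ s k).bitIndices) :
    a ∈ ({Nat.log 2 (2 ^ k + 2 ^ s k), s (Nat.log 2 (2 ^ k + 2 ^ s k))} : Finset ℕ) := by
  rcases hs.eq_or_lt with h_eq | h_lt
  · have h_double : 2 ^ k + 2 ^ s k = 2 ^ (k + 1) := by rw [h_eq, pow_succ, mul_two]
    rw [h_double, Nat.bitIndices_two_pow, List.mem_singleton] at ha
    rw [h_double, Nat.log_pow one_lt_two, ha]
    exact Finset.mem_insert_self _ _
  · have h_log : Nat.log 2 (2 ^ k + 2 ^ s k) = k := by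
      refine Nat.log_eq_of_pow_le_of_lt_pow (Nat.le_add_right _ _) ?_
      rw [pow_succ, mul_two]
      gcongr
      exact one_lt_two
    have h_digits : (2 ^ k + 2 ^ s k).bitIndices = [s k, k] := by
      simpa [add_comm] using Nat.bitIndices_sum_map_two_pow (L := [s k, k])
        (List.Pairwise.sortedLT (List.pairwise_pair.2 h_lt))
    rw [h_log]
    simpa [h_digits, or_comm] using ha

end WalshFejer

open WalshFejer in
theorem corollary2_general {𝕜 : Type*} [RCLike 𝕜] {r : ℕ} {A : ℕ → Finset ℕ}
    (hA : ∀ k, (A k).card ≤ r) {n : ℕ → ℕ}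
    (hn : ∀ i, ∀ a ∈ (n i).bitIndices, a ∈ A (Nat.log 2 (n i))) :
    BoundedHardyLp (1 / 2) (restrictedMaximal (𝕜 := 𝕜) n) := by
  refine boundedHardyLp_of_le_sq (48 * r) fun F hF => ?_
  set B : G → ℝ≥0∞ := fun x => maximalFunction F x ^ (1 / 2 : ℝ)
  have h_monotone := monotone_sqrtMaximal F
  have h_adapted := adapted_sqrtMaximal hF
  have h_le : ∀ n x, sqrtMaximal F n x ≤ B x := sqrtMaximal_le F
  refine ⟨fun x => 2 * majorant (sqrtMaximal F) B r A x, fun i x => ?_, ?_⟩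
  · have h_digits : (n i).bitIndices.toFinset ⊆ A (Nat.log 2 (n i)) := fun a ha =>
      hn i a (List.mem_toFinset.1 ha)
    refine (enorm_fejerMean_le hF (n i) x).trans ?_
    beta_reduce
    gcongr
    exact sum_translateSum_le_majorant h_monotone h_adapted h_le hA h_digits x
  · rw [lintegral_const_mul' _ _ ENNReal.ofNat_ne_top]
    calc 2 * ∫⁻ x, majorant (sqrtMaximal F) B r A x ∂mu ≤ 2 * (24 * r * ∫⁻ x, B x ∂mu) := by
          gcongr
          exact lintegral_majorant_le h_monotone h_adapted h_le hA
      _ = (48 * r : ℝ≥0) * ∫⁻ x, B x ∂mu := by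
          push_cast
          ring

theorem corollary2 {𝕜 : Type*} [RCLike 𝕜] :
    WalshFejer.BoundedHardyLp (1 / 2)
        (WalshFejer.restrictedMaximal (𝕜 := 𝕜) (fun k => 2 ^ k)) ∧
      WalshFejer.BoundedHardyLp (1 / 2)
        (WalshFejer.restrictedMaximal (𝕜 := 𝕜) (fun k => 2 ^ k + 1)) ∧
      WalshFejer.BoundedHardyLp (1 / 2)
        (WalshFejer.restrictedMaximal (𝕜 := 𝕜) (fun k => 2 ^ k + 2 ^ (k / 2))) :=
  ⟨corollary2_general (A := fun k => {k}) (fun _ => (Finset.card_singleton _).le) fun k a => by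
      simp [Nat.log_pow],
    corollary2_general (A := fun k => {k, 0}) (fun _ => Finset.card_le_two) fun k _ =>
      WalshFejer.mem_pair_of_mem_bitIndices_two_pow_add_two_pow (s := fun _ => 0) k.zero_le,
    corollary2_general (A := fun k => {k, k / 2}) (fun _ => Finset.card_le_two) fun k _ =>
      WalshFejer.mem_pair_of_mem_bitIndices_two_pow_add_two_pow (s := fun k => k / 2)
        (k.div_le_self 2)⟩
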